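/- **Setting.** Let $S,U^p,U^a$ be finite sets, $p(\cdot\mid\theta,u^p,u^a)$ a transition kernel on $S$, $K\subset\mathbb R^d$ compact, and $\kappa:S\times U^p\times U^a\to K$ a reward function. Let $\Pi^p$ (resp. $\Pi^a$) be the set of maps from $S$ to the probability distributions on $U^p$ (resp. $U^a$). Assume that for every fixed pair $(\pi^p,\pi^a)\in\Pi^p\times\Pi^a$ the resulting Markov chain on $S$ is ergodic (irreducibility is enough), let $\eta^{(\pi^p,\pi^a)}$ be its stationary distribution, and put $$\bar\kappa(\pi^p,\pi^a)=\sum_{\theta,u^p,u^a}\kappa(\theta,u^p,u^a)\,\eta^{(\pi^p,\pi^a)}(\theta)\,\pi^p(u^p|\theta)\,\pi^a(u^a|\theta),\qquad R(\pi^p)=\{\bar\kappa(\pi^p,\pi^a):\pi^a\in\Pi^a\}.$$ Let $\emptyset\ne D\subset K$ with $\bar D$ convex, and let $y_{\bar D}$ denote the point of $\bar D$ closest to $y$. For each $x\in K\setminus\bar D$ let $\pi^p_x\in\Pi^p$ and $\rho(x)>0$ be such that $\inf_{\pi^a}\langle\bar\kappa(\pi^p_x,\pi^a)-x_{\bar D},x_{\bar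 D}-x\rangle>0$ and $\inf_{y\in B(x,\rho(x))}\inf_{\pi^a}\langle\bar\kappa(\pi^p_x,\pi^a)-y_{\bar D},y_{\bar D}-y\rangle>0$. For $n\ge0$ let $K_n=\{y\in K:\operatorname{dist}(y,D)\in[\frac1{n+1},\frac1n]\}$ (with $\frac10=\infty$), let $\mathcal Q_n\subset K_n$ be finite with $K_n\subset\bigcup_{q\in\mathcal Q_n}B(q,\rho(q)/2)$, and let $\mathcal Q=\bigcup_n\mathcal Q_n$. Let $I:\mathcal Q\to\mathbb N$ be injective, and for $x\in K\setminus\bar D$ let $Q(x)$ be the $q\in\mathcal Q$ with $x\in B(q,\rho(q)/2)$ for which $I(q)$ is least. Let $v_{\max}=\sup_{x\in K}\sup_{\theta,u^p,u^a}\|\kappa(\theta,u^p,u^a)-x\|$ and let $T:\mathcal Q\to\mathbb R$ satisfy $\frac{\rho(q)}{4v_{\max}}<T(q)<\frac{\rho(q)}{3v_{\max}}$. Fix any $\pi^p_0\in\Pi^p$ and put $t(n)=\sum_{i=1}^n\frac1i$. **Play.** Let $\theta_n,u^p_n,u^a_n$ be the states and actions at times $n\ge0$, let $\kappa_n=\kappa(\theta_n,u^p_n,u^a_n)$,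 and let $x_{n+1}=x_n+\frac1{n+1}(\kappa_n-x_n)$ be the average reward, started at an arbitrary $x_0\in\mathbb R^d$. The switching times are $s_0=0$ and, if $x_{s_n}\in K\setminus\bar D$, $s_{n+1}=\min\{m:\sum_{i=s_n}^{m-1}\frac1i>T(Q(x_{s_n}))\}$ (the term $i=0$ is omitted if $s_n=0$), while $s_{n+1}=s_n+1$ otherwise. At the times $s_n\le j<s_{n+1}$ the player uses the strategy $\pi^p_{Q(x_{s_n})}$ if $x_{s_n}\in K\setminus\bar D$, and $\pi^p_0$ otherwise. At each time the adversary uses a strategy in $\Pi^a$ chosen in an arbitrary way depending on the past. Given the past (any filtration containing the history), the two actions are drawn independently from the two current strategies evaluated at the current state, and then the next state is drawn from $p$. **Conditions $(\dag)$** on a path, a strictly increasing sequence $m(n)$, integers $s_{m(n)}\le l_{m(n)}<r_{m(n)}\le s_{m(n)+1}$, reals $T_l<T_r$ and $q\in\mathcal Q$: (1) $x_{s_{m(n)}}\to x$ for some $x\in K\setminus\bar D$; (2) $x_{s_{m(n)}}\in K\setminus\bar D$ and $Q(x_{s_{m(n)}})=q$ for all $n$; (3) $[T_l,T_r)\subset[0,T(q))$;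 (4) $t(l_{m(n)})-t(s_{m(n)})\to T_l$ and $t(r_{m(n)})-t(s_{m(n)})\to T_r$. **Statement.** Whatever the adversary's behaviour, almost surely the following holds: for all (possibly path-dependent) choices of $m(n),l_{m(n)},r_{m(n)},T_l,T_r,q$ which satisfy $(\dag)$, $$\lim_{n\to\infty}\ \inf_{\pi^a\in\Pi^a}\left\|\frac{\sum_{j=l_{m(n)}}^{r_{m(n)}-1}\kappa(\theta_j,u^p_j,u^a_j)}{r_{m(n)}-l_{m(n)}}-\bar\kappa(\pi^p_q,\pi^a)\right\|=0,$$ that is, the averages of the rewards over the windows $[l_{m(n)},r_{m(n)})$ converge to the set $R(\pi^p_q)$. Moreover, $\lim_n r_{m(n)}/l_{m(n)}=\exp(T_r-T_l)$, and hence $\lim_n (r_{m(n)}-l_{m(n)})/l_{m(n)}=\exp(T_r-T_l)-1$. -/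

import Mathlib

open MeasureTheory ProbabilityTheory Filter Topology

noncomputable section

namespace Approach

/-- The reward space `ℝ^d` with its Euclidean norm. -/
abbrev Vec (d : ℕ) : Type := EuclideanSpace ℝ (Fin d)

/-- Stationary randomized strategies: maps from states to probability vectors on actions. -/
abbrev Strategy (S U : Type*) [Fintype U] : Type _ := S → stdSimplex ℝ U

/-- A controlled Markov chain with two controllers and a vector reward: `p θ a b` is the law of
the next state and `κ θ a b` the reward, in state `θ` under the player's action `a` and the
adversary's action `b`. -/
structure Game (S Up Ua : Type*) [Fintype S] (d : ℕ) where
  p : S → Up → Ua → stdSimplex ℝ S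
  κ : S → Up → Ua → Vec d

section Stationary

variable {S Up Ua : Type*} [Fintype S] [Fintype Up] [Fintype Ua] {d : ℕ}

/-- Transition matrix of the state process under a fixed pair of strategies. -/
def Game.trans (G : Game S Up Ua d) (πp : Strategy S Up) (πa : Strategy S Ua) : Matrix S S ℝ :=
  fun θ θ' => ∑ a, ∑ b, πp θ a * πa θ b * G.p θ a b θ'

/-- `η` is a stationary probability vector of the transition matrix `P`. -/
def IsStationary (P : Matrix S S ℝ) (η : S → ℝ) : Prop :=
  η ∈ stdSimplex ℝ S ∧ ∀ θ', ∑ θ, η θ * P θ θ' = η θ'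

/-- The chain is ergodic under every fixed pair of strategies. Only irreducibility is demanded,
so aperiodic and periodic irreducible chains are both covered. -/
def Game.Ergodic (G : Game S Up Ua d) : Prop :=
  ∀ (πp : Strategy S Up) (πa : Strategy S Ua), (G.trans πp πa).IsIrreducible

/-- The stationary probability vector of the chain under a fixed pair of strategies
(it exists and is unique when the chain is irreducible). -/
def Game.statDist (G : Game S Up Ua d) (πp : Strategy S Up) (πa : Strategy S Ua) : S → ℝ :=
  Classical.epsilon (IsStationary (G.trans πp πa))

/-- The stationary average reward of a pair of strategies. -/
def Game.meanReward (G : Game S Up Ua d) (πp : Strategy S Up) (πa : Strategy S Ua) : Vec d :=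
  ∑ θ, ∑ a, ∑ b, (G.statDist πp πa θ * πp θ a * πa θ b) • G.κ θ a b

/-- The set of stationary average rewards achievable against the player's strategy `πp`. -/
def Game.rewardSet (G : Game S Up Ua d) (πp : Strategy S Up) : Set (Vec d) :=
  Set.range (G.meanReward πp)

/-- `v_max`, the supremum of `‖κ(θ, u^p, u^a) - x‖` over `x ∈ K` and all `θ, u^p, u^a`. -/
def Game.vmax (G : Game S Up Ua d) (K : Set (Vec d)) : ℝ :=
  sSup {v | ∃ x ∈ K, ∃ θ a b, v = ‖G.κ θ a b - x‖}

end Stationary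

/-- The point of the closure of `D` closest to `y`. -/
def proj {d : ℕ} (D : Set (Vec d)) (y : Vec d) : Vec d :=
  Classical.epsilon fun z => z ∈ closure D ∧ dist y z = Metric.infDist y (closure D)

/-- The layer `K_n` of points of `K` whose distance to `D` lies in `[1/(n+1), 1/n]`; for `n = 0`
the upper end is infinite, so that the layers exhaust `K \ closure D`. -/
def layer {d : ℕ} (K D : Set (Vec d)) (n : ℕ) : Set (Vec d) :=
  {y | y ∈ K ∧ 1 / ((n : ℝ) + 1) ≤ Metric.infDist y D ∧ (n : ℝ) * Metric.infDist y D ≤ 1}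

/-- Rescaled time `t(n) = 1 + 1/2 + ... + 1/n`. -/
def clock (n : ℕ) : ℝ := ∑ i ∈ Finset.Icc 1 n, (1 : ℝ) / i

/-- Average reward: `x_{n+1} = x_n + (g_n - x_n)/(n+1)`, started at `x₀`. -/
def average {d : ℕ} (x₀ : Vec d) (g : ℕ → Vec d) : ℕ → Vec d
  | 0 => x₀
  | n + 1 => average x₀ g n + (1 / ((n : ℝ) + 1)) • (g n - average x₀ g n)

section Scheme

variable {S Up Ua : Type*} [Fintype S] [Fintype Up] [Fintype Ua] {d : ℕ}

/-- The choices which determine the player's scheme: strategies `π^p_x` and radii `ρ(x)` for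
`x ∈ K \ closure D`, a fallback strategy `π^p_0`, finite nets `𝒬_n` of the layers `K_n`, an
injective numbering `I` of the union `𝒬` of the nets, and durations `T(q)` for `q ∈ 𝒬`.
The values of `strat`, `ρ`, `I`, `T` outside these domains play no role. -/
structure Scheme (G : Game S Up Ua d) (K D : Set (Vec d)) where
  strat : Vec d → Strategy S Up
  strat₀ : Strategy S Up
  ρ : Vec d → ℝ
  net : ℕ → Finset (Vec d)
  I : Vec d → ℕ
  T : Vec d → ℝ
  /-- Blackwell's condition:
  `inf_{π^a} ⟨κ̄(π^p_x, π^a) - x_{D̄}, x_{D̄} - x⟩ > 0`. -/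
  blackwell : ∀ x ∈ K \ closure D, ∃ ε > 0, ∀ πa : Strategy S Ua,
    ε ≤ inner ℝ (G.meanReward (strat x) πa - proj D x) (proj D x - x)
  ρ_pos : ∀ x ∈ K \ closure D, 0 < ρ x
  /-- The same strategy works on the whole ball:
  `inf_{y ∈ B(x, ρ(x))} inf_{π^a} ⟨κ̄(π^p_x, π^a) - y_{D̄}, y_{D̄} - y⟩ > 0`. -/
  ρ_spec : ∀ x ∈ K \ closure D, ∃ ε > 0, ∀ y ∈ Metric.ball x (ρ x), ∀ πa : Strategy S Ua,
    ε ≤ inner ℝ (G.meanReward (strat x) πa - proj D y) (proj D y - y)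
  net_subset : ∀ n, (net n : Set (Vec d)) ⊆ layer K D n
  net_cover : ∀ n, layer K D n ⊆ ⋃ q ∈ net n, Metric.ball q (ρ q / 2)
  I_injOn : Set.InjOn I (⋃ n, (net n : Set (Vec d)))
  T_spec : ∀ q ∈ (⋃ n, (net n : Set (Vec d))),
    ρ q / (4 * G.vmax K) < T q ∧ T q < ρ q / (3 * G.vmax K)

variable {G : Game S Up Ua d} {K D : Set (Vec d)}

/-- The countable set `𝒬`, the union of the nets. -/
def Scheme.centers (C : Scheme G K D) : Set (Vec d) := ⋃ n, (C.net n : Set (Vec d))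

/-- `q` has the least number among the points of `𝒬` with `x ∈ B(q, ρ(q)/2)`. -/
def Scheme.IsLeastCenter (C : Scheme G K D) (x q : Vec d) : Prop :=
  (q ∈ C.centers ∧ x ∈ Metric.ball q (C.ρ q / 2)) ∧
    ∀ q' ∈ C.centers, x ∈ Metric.ball q' (C.ρ q' / 2) → C.I q ≤ C.I q'

/-- The map `Q : K \ closure D → 𝒬`. -/
def Scheme.center (C : Scheme G K D) (x : Vec d) : Vec d :=
  Classical.epsilon (C.IsLeastCenter x)

open Classical in
/-- The strategy adopted at a switching time at which the average reward is `x`: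
`π^p_{Q(x)}` if `x ∈ K \ closure D`, and `π^p_0` otherwise. -/
def Scheme.adopt (C : Scheme G K D) (x : Vec d) : Strategy S Up :=
  if x ∈ K \ closure D then C.strat (C.center x) else C.strat₀

open Classical in
/-- The switching times `s_n` along a sequence `x` of average rewards: `s_0 = 0`; if
`x_{s_n} ∈ K \ closure D`, then `s_{n+1}` is the least `m` with
`∑_{i = s_n}^{m-1} 1/i > T(Q(x_{s_n}))`, and otherwise `s_{n+1} = s_n + 1`.
When `s_n = 0` the undefined term `i = 0` is left out of the sum. -/
def Scheme.switch (C : Scheme G K D) (x : ℕ → Vec d) : ℕ → ℕ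
  | 0 => 0
  | n + 1 =>
    if x (C.switch x n) ∈ K \ closure D then
      sInf {m : ℕ | C.T (C.center (x (C.switch x n))) <
        ∑ i ∈ Finset.Ico (max 1 (C.switch x n)) m, (1 : ℝ) / i}
    else C.switch x n + 1

open Classical in
/-- The last switching time `s_k ≤ j` (note that `k ≤ s_k`). -/
def Scheme.lastSwitch (C : Scheme G K D) (x : ℕ → Vec d) (j : ℕ) : ℕ :=
  C.switch x (Nat.findGreatest (fun k => C.switch x k ≤ j) j)

/-- The player's strategy at time `j`: the one adopted at the last switching time. -/
def Scheme.current (C : Scheme G K D) (x : ℕ → Vec d) (j : ℕ) : Strategy S Up :=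
  C.adopt (x (C.lastSwitch x j))

/-- The sequence of rewards along given states and actions. -/
def Game.reward (G : Game S Up Ua d) {Ω : Type*} (θ : ℕ → Ω → S) (up : ℕ → Ω → Up)
    (ua : ℕ → Ω → Ua) (ω : Ω) (n : ℕ) : Vec d :=
  G.κ (θ n ω) (up n ω) (ua n ω)

/-- States `θ`, player's actions `up` and adversary's actions `ua` form a play in which the player
follows the scheme and the adversary uses the strategies `α n`, chosen at time `n` in an arbitrary
way from the past `ℱ n` (any filtration that contains the history). Given the past, the two
actions at time `n` are drawn independently from the current strategies and then the next state
from the transition kernel. -/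
structure IsPlay (C : Scheme G K D) (x₀ : Vec d) {Ω : Type*} [mΩ : MeasurableSpace Ω]
    (μ : Measure Ω) (ℱ : Filtration ℕ mΩ) (θ : ℕ → Ω → S) (up : ℕ → Ω → Up) (ua : ℕ → Ω → Ua)
    (α : ℕ → Ω → Strategy S Ua) : Prop where
  meas_state : ∀ n i, MeasurableSet[ℱ n] {ω | θ n ω = i}
  meas_player : ∀ n a, MeasurableSet[ℱ (n + 1)] {ω | up n ω = a}
  meas_adversary : ∀ n b, MeasurableSet[ℱ (n + 1)] {ω | ua n ω = b}
  meas_strategy : ∀ n i b, Measurable[ℱ n] fun ω => α n ω i b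
  step : ∀ n a b i,
    μ⟦{ω | up n ω = a ∧ ua n ω = b ∧ θ (n + 1) ω = i} | ℱ n⟧ =ᵐ[μ] fun ω =>
      C.current (average x₀ (G.reward θ up ua ω)) n (θ n ω) a * α n ω (θ n ω) b *
        G.p (θ n ω) a b i

/-- The conditions `(†)` along one path `x` of average rewards: `s_{m(n)}` is a subsequence of the
switching times, the windows `[l n, r n)` satisfy `s_{m(n)} ≤ l n < r n ≤ s_{m(n)+1}`, and

1. `x_{s_{m(n)}}` converges to a point of `K \ closure D`;
2. `Q(x_{s_{m(n)}}) = q ∈ 𝒬` for all `n` (in particular `x_{s_{m(n)}}` is in the domain of `Q`);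
3. `[T_l, T_r) ⊆ [0, T(q))`;
4. `t(l n) - t(s_{m(n)}) → T_l` and `t(r n) - t(s_{m(n)}) → T_r`. -/
structure Dagger (C : Scheme G K D) (x : ℕ → Vec d) (m l r : ℕ → ℕ) (Tl Tr : ℝ)
    (q : Vec d) : Prop where
  strictMono : StrictMono m
  lt : Tl < Tr
  window : ∀ n, C.switch x (m n) ≤ l n ∧ l n < r n ∧ r n ≤ C.switch x (m n + 1)
  tendsto : ∃ z ∈ K \ closure D, Tendsto (fun n => x (C.switch x (m n))) atTop (𝓝 z)
  mem_centers : q ∈ C.centers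
  center_eq : ∀ n, x (C.switch x (m n)) ∈ K \ closure D ∧ C.center (x (C.switch x (m n))) = q
  subset : Set.Ico Tl Tr ⊆ Set.Ico 0 (C.T q)
  tendsto_left : Tendsto (fun n => clock (l n) - clock (C.switch x (m n))) atTop (𝓝 Tl)
  tendsto_right : Tendsto (fun n => clock (r n) - clock (C.switch x (m n))) atTop (𝓝 Tr)

end Scheme

end Approach

end

/-!
Convergence of the rescaled time increment to `T > 0` makes the window lengths proportional to the
starting times, because harmonic numbers are logarithms up to a convergent error. The strong law for
martingale differences says that over `[0, n)` each transition occurs, up to `o(n)`, as often as its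
conditional probabilities predict; this survives on windows of proportional length. While the
player's strategy is `πp`, the predicted law of a transition is linear in the law `w` of the state
and the adversary's action. The numbers of arrivals at and departures from a state over a window
differ by at most one, so every limit point of the averages of `w` has zero net flux. It is then of
the form `ν(θ) β(u^a | θ)` with `ν` stationary for `(πp, β)`, hence equal to the stationary law by
irreducibility, and its expected reward lies in `R(πp)`; compactness concludes.
-/

namespace Approach

section StrongLaw

/-- Kronecker's lemma for the weights `n + 1`: summation by parts turns the average of `e` into the
difference between the partial sums of the series and their Cesàro means. -/
theorem tendsto_average_zero_of_tendsto_sum_inv_smul {E : Type*} [NormedAddCommGroup E]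
    [NormedSpace ℝ E] {e : ℕ → E} {c : E}
    (h : Tendsto (fun n => ∑ j ∈ Finset.range n, ((j : ℝ) + 1)⁻¹ • e j) atTop (𝓝 c)) :
    Tendsto (fun n : ℕ => (n : ℝ)⁻¹ • ∑ j ∈ Finset.range n, e j) atTop (𝓝 0) := by
  set M : ℕ → E := fun n => ∑ j ∈ Finset.range n, ((j : ℝ) + 1)⁻¹ • e j
  have sum_by_parts (n : ℕ) :
      ∑ j ∈ Finset.range n, e j = (n : ℝ) • M n - ∑ j ∈ Finset.range n, M j := by
    induction n with
    | zero => simp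
    | succ n ih =>
      have hM : M (n + 1) = M n + ((n : ℝ) + 1)⁻¹ • e n := Finset.sum_range_succ _ _
      rw [Finset.sum_range_succ, Finset.sum_range_succ, ih, hM, Nat.cast_add_one, smul_add,
        smul_inv_smul₀ (by positivity)]
      module
  have hlim := h.sub h.cesaro_smul
  rw [sub_self] at hlim
  refine hlim.congr' ?_
  filter_upwards [eventually_ne_atTop 0] with n hn
  rw [sum_by_parts n, smul_sub, inv_smul_smul₀ (by exact_mod_cast hn)]

variable {Ω : Type*} {mΩ : MeasurableSpace Ω} {μ : Measure Ω}

theorem integral_mul_eq_zero_of_condExp_eq_zero {m : MeasurableSpace Ω} (hm : m ≤ mΩ)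
    [SigmaFinite (μ.trim hm)] {f g : Ω → ℝ} (hf : StronglyMeasurable[m] f)
    (hfg : Integrable (f * g) μ) (hg : Integrable g μ) (hcond : μ[g | m] =ᵐ[μ] 0) :
    ∫ ω, f ω * g ω ∂μ = 0 := by
  refine (integral_condExp (f := f * g) hm).symm.trans (integral_eq_zero_of_ae ?_)
  filter_upwards [condExp_mul_of_stronglyMeasurable_left hf hfg hg, hcond] with ω hpull hzero
  rw [hpull, Pi.mul_apply, hzero, Pi.zero_apply, mul_zero]

theorem ae_norm_indicator_sub_condExp_le {m : MeasurableSpace Ω} (A : Set Ω) :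
    ∀ᵐ ω ∂μ, ‖A.indicator (fun _ => (1 : ℝ)) ω - (μ⟦A | m⟧) ω‖ ≤ 2 := by
  have hind (ω : Ω) : |A.indicator (fun _ => (1 : ℝ)) ω| ≤ 1 := by
    by_cases hω : ω ∈ A <;> simp [hω]
  filter_upwards [ae_bdd_abs_condExp_of_ae_bdd_abs (m := m) (.of_forall hind)] with ω hω
  exact (abs_sub _ _).trans ((add_le_add (hind ω) hω).trans_eq one_add_one_eq_two)

variable [IsFiniteMeasure μ] {ℱ : Filtration ℕ mΩ}

theorem stronglyMeasurable_sum_range {E : Type*} [NormedAddCommGroup E] {e : ℕ → Ω → E}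
    (hmeas : ∀ n, StronglyMeasurable[ℱ (n + 1)] (e n)) (n : ℕ) :
    StronglyMeasurable[ℱ n] (∑ j ∈ Finset.range n, e j) :=
  Finset.stronglyMeasurable_sum _ fun j hj => (hmeas j).mono (ℱ.mono (Finset.mem_range.1 hj))

theorem martingale_sum_range {E : Type*} [NormedAddCommGroup E] [NormedSpace ℝ E]
    [CompleteSpace E] {e : ℕ → Ω → E} (hmeas : ∀ n, StronglyMeasurable[ℱ (n + 1)] (e n))
    (hint : ∀ n, Integrable (e n) μ) (hcond : ∀ n, μ[e n | ℱ n] =ᵐ[μ] 0) :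
    Martingale (fun n => ∑ j ∈ Finset.range n, e j) ℱ μ := by
  refine martingale_of_condExp_sub_eq_zero_nat (stronglyMeasurable_sum_range hmeas)
    (fun n => integrable_finsetSum' _ fun j _ => hint j) fun n => ?_
  rw [Finset.sum_range_succ_sub_sum]
  exact hcond n

theorem integral_sq_sum_range {e : ℕ → Ω → ℝ} (hmeas : ∀ n, StronglyMeasurable[ℱ (n + 1)] (e n))
    (hL2 : ∀ n, MemLp (e n) 2 μ) (hcond : ∀ n, μ[e n | ℱ n] =ᵐ[μ] 0) (n : ℕ) :
    ∫ ω, ((∑ j ∈ Finset.range n, e j) ω) ^ 2 ∂μ = ∑ j ∈ Finset.range n, ∫ ω, e j ω ^ 2 ∂μ := by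
  induction n with
  | zero => simp
  | succ n ih =>
    set M : Ω → ℝ := ∑ j ∈ Finset.range n, e j
    have hM : MemLp M 2 μ := memLp_finsetSum' _ fun j _ => hL2 j
    have hMe : Integrable (fun ω => M ω * e n ω) μ := hM.integrable_mul (hL2 n)
    have hcross : ∫ ω, M ω * e n ω ∂μ = 0 :=
      integral_mul_eq_zero_of_condExp_eq_zero (ℱ.le n) (stronglyMeasurable_sum_range hmeas n)
        hMe ((hL2 n).integrable one_le_two) (hcond n)
    have hsq : Integrable (fun ω => M ω ^ 2 + 2 * (M ω * e n ω)) μ :=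
      hM.integrable_sq.add (hMe.const_mul 2)
    calc ∫ ω, ((∑ j ∈ Finset.range (n + 1), e j) ω) ^ 2 ∂μ
        = ∫ ω, (M ω ^ 2 + 2 * (M ω * e n ω) + e n ω ^ 2) ∂μ := by
          rw [Finset.sum_range_succ]
          exact integral_congr_ae (.of_forall fun ω => by simp only [Pi.add_apply]; ring)
      _ = ∫ ω, M ω ^ 2 ∂μ + 2 * ∫ ω, M ω * e n ω ∂μ + ∫ ω, e n ω ^ 2 ∂μ := by
          rw [integral_add hsq (hL2 n).integrable_sq,
            integral_add hM.integrable_sq (hMe.const_mul 2), integral_const_mul]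
      _ = ∑ j ∈ Finset.range (n + 1), ∫ ω, e j ω ^ 2 ∂μ := by
          rw [hcross, ih, mul_zero, add_zero, Finset.sum_range_succ]

theorem eLpNorm_one_le_of_integral_sq_le {f : Ω → ℝ} (hf : MemLp f 2 μ) {B : ℝ}
    (hB : ∫ ω, f ω ^ 2 ∂μ ≤ B) : eLpNorm f 1 μ ≤ ENNReal.ofReal (μ.real Set.univ + B) := by
  have hint : Integrable f μ := hf.integrable one_le_two
  rw [eLpNorm_one_eq_lintegral_enorm, ← ofReal_integral_norm_eq_lintegral_enorm hint]
  refine ENNReal.ofReal_le_ofReal ?_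
  calc ∫ ω, ‖f ω‖ ∂μ ≤ ∫ ω, (1 + f ω ^ 2) ∂μ := by
        refine integral_mono hint.norm ((integrable_const _).add hf.integrable_sq) fun ω => ?_
        simp only [Real.norm_eq_abs]
        nlinarith [sq_abs (f ω), sq_nonneg (|f ω| - 1), abs_nonneg (f ω)]
    _ = μ.real Set.univ + ∫ ω, f ω ^ 2 ∂μ := by
        rw [integral_add (integrable_const _) hf.integrable_sq, integral_const, smul_eq_mul,
          mul_one]
    _ ≤ μ.real Set.univ + B := by gcongr

theorem ae_exists_tendsto_sum_of_summable_integral_sq {e : ℕ → Ω → ℝ}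
    (hmeas : ∀ n, StronglyMeasurable[ℱ (n + 1)] (e n)) (hL2 : ∀ n, MemLp (e n) 2 μ)
    (hcond : ∀ n, μ[e n | ℱ n] =ᵐ[μ] 0) (hsum : Summable fun n => ∫ ω, e n ω ^ 2 ∂μ) :
    ∀ᵐ ω ∂μ, ∃ c, Tendsto (fun n => ∑ j ∈ Finset.range n, e j ω) atTop (𝓝 c) := by
  have hmart := martingale_sum_range hmeas (fun n => (hL2 n).integrable one_le_two) hcond
  have hsq (n : ℕ) : ∫ ω, ((∑ j ∈ Finset.range n, e j) ω) ^ 2 ∂μ ≤ ∑' j, ∫ ω, e j ω ^ 2 ∂μ := by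
    rw [integral_sq_sum_range hmeas hL2 hcond]
    exact hsum.sum_le_tsum _ fun j _ => integral_nonneg fun ω => sq_nonneg _
  have hconv := hmart.submartingale.exists_ae_tendsto_of_bdd fun n =>
    eLpNorm_one_le_of_integral_sq_le (memLp_finsetSum' _ fun j _ => hL2 j) (hsq n)
  simpa only [Finset.sum_apply] using hconv

theorem ae_tendsto_average_zero_of_condExp_eq_zero {e : ℕ → Ω → ℝ}
    (hmeas : ∀ n, StronglyMeasurable[ℱ (n + 1)] (e n)) (hL2 : ∀ n, MemLp (e n) 2 μ)
    (hcond : ∀ n, μ[e n | ℱ n] =ᵐ[μ] 0)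
    (hsum : Summable fun n : ℕ => (((n : ℝ) + 1)⁻¹) ^ 2 * ∫ ω, e n ω ^ 2 ∂μ) :
    ∀ᵐ ω ∂μ, Tendsto (fun n : ℕ => (n : ℝ)⁻¹ * ∑ j ∈ Finset.range n, e j ω) atTop (𝓝 0) := by
  have hconv := ae_exists_tendsto_sum_of_summable_integral_sq (ℱ := ℱ) (μ := μ)
    (e := fun n => ((n : ℝ) + 1)⁻¹ • e n) (fun n => (hmeas n).const_smul _)
    (fun n => (hL2 n).const_smul _)
    (fun n => by
      filter_upwards [condExp_smul ((n : ℝ) + 1)⁻¹ (e n) (ℱ n), hcond n] with ω hsmul hzero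
      rw [hsmul, Pi.smul_apply, hzero, Pi.zero_apply, smul_zero])
    (by simpa only [Pi.smul_apply, smul_eq_mul, mul_pow, integral_const_mul] using hsum)
  filter_upwards [hconv] with ω ⟨c, hc⟩
  exact tendsto_average_zero_of_tendsto_sum_inv_smul hc

theorem summable_inv_natCast_add_one_sq : Summable fun n : ℕ => (((n : ℝ) + 1)⁻¹) ^ 2 := by
  simpa using (summable_nat_add_iff 1).2 (Real.summable_nat_pow_inv.2 one_lt_two)

theorem ae_tendsto_average_zero_of_condExp_eq_zero_of_norm_le {e : ℕ → Ω → ℝ}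
    (hmeas : ∀ n, StronglyMeasurable[ℱ (n + 1)] (e n)) {B : ℝ}
    (hbound : ∀ n, ∀ᵐ ω ∂μ, ‖e n ω‖ ≤ B) (hcond : ∀ n, μ[e n | ℱ n] =ᵐ[μ] 0) :
    ∀ᵐ ω ∂μ, Tendsto (fun n : ℕ => (n : ℝ)⁻¹ * ∑ j ∈ Finset.range n, e j ω) atTop (𝓝 0) := by
  have hL2 (n : ℕ) : MemLp (e n) 2 μ :=
    .of_bound ((hmeas n).mono (ℱ.le _)).aestronglyMeasurable B (hbound n)
  have hsq (n : ℕ) : ∫ ω, e n ω ^ 2 ∂μ ≤ μ.real Set.univ * B ^ 2 := by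
    refine (integral_mono_ae (hL2 n).integrable_sq (integrable_const (B ^ 2)) ?_).trans_eq
      (by rw [integral_const, smul_eq_mul])
    filter_upwards [hbound n] with ω hω
    exact sq_le_sq' (abs_le.1 hω).1 (abs_le.1 hω).2
  refine ae_tendsto_average_zero_of_condExp_eq_zero hmeas hL2 hcond
    (.of_nonneg_of_le (fun n => ?_) (fun n => ?_)
      (summable_inv_natCast_add_one_sq.mul_right (μ.real Set.univ * B ^ 2)))
  · exact mul_nonneg (sq_nonneg _) (integral_nonneg fun ω => sq_nonneg _)
  · exact mul_le_mul_of_nonneg_left (hsq n) (sq_nonneg _)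

theorem ae_tendsto_average_indicator_sub_condExp {A : ℕ → Set Ω}
    (hA : ∀ n, MeasurableSet[ℱ (n + 1)] (A n)) :
    ∀ᵐ ω ∂μ, Tendsto (fun n : ℕ => (n : ℝ)⁻¹ * ∑ j ∈ Finset.range n,
      ((A j).indicator (fun _ => (1 : ℝ)) ω - (μ⟦A j | ℱ j⟧) ω)) atTop (𝓝 0) := by
  refine ae_tendsto_average_zero_of_condExp_eq_zero_of_norm_le (ℱ := ℱ)
    (fun n => (stronglyMeasurable_const.indicator (hA n)).sub
      (stronglyMeasurable_condExp.mono (ℱ.mono n.le_succ)))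
    (fun n => ae_norm_indicator_sub_condExp_le (A n)) fun n => ?_
  have hind : Integrable ((A n).indicator fun _ => (1 : ℝ)) μ :=
    (integrable_const _).indicator (ℱ.le _ _ (hA n))
  refine (condExp_sub hind integrable_condExp _).trans ?_
  rw [condExp_of_stronglyMeasurable (ℱ.le n) stronglyMeasurable_condExp integrable_condExp,
    sub_self]

end StrongLaw

section StationaryLaws

variable {S : Type*} [Fintype S]

theorem vecMul_pow_eq_self [DecidableEq S] {P : Matrix S S ℝ} {w : S → ℝ}
    (h : Matrix.vecMul w P = w) (n : ℕ) : Matrix.vecMul w (P ^ n) = w := by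
  induction n with
  | zero => rw [pow_zero, Matrix.vecMul_one]
  | succ n ih => rw [pow_succ, ← Matrix.vecMul_vecMul, ih, h]

theorem eq_zero_of_vecMul_eq_self_of_apply_eq_zero {P : Matrix S S ℝ} (hP : P.IsIrreducible)
    {w : S → ℝ} (hw : 0 ≤ w) (hinv : Matrix.vecMul w P = w) {k : S} (hk : w k = 0) : w = 0 := by
  classical
  funext i
  obtain ⟨n, -, hn⟩ := (Matrix.isIrreducible_iff_exists_pow_pos hP.nonneg).1 hP i k
  have hsum : ∑ i, w i * (P ^ n) i k = 0 := (congrFun (vecMul_pow_eq_self hinv n) k).trans hk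
  have hterm : w i * (P ^ n) i k = 0 := (Finset.sum_eq_zero_iff_of_nonneg fun i _ =>
    mul_nonneg (hw i) (Matrix.pow_apply_nonneg hP.nonneg n i k)).1 hsum i (Finset.mem_univ i)
  exact (mul_eq_zero.1 hterm).resolve_right hn.ne'

theorem isStationary_iff {P : Matrix S S ℝ} {η : S → ℝ} :
    IsStationary P η ↔ η ∈ stdSimplex ℝ S ∧ Matrix.vecMul η P = η :=
  and_congr_right fun _ => funext_iff.symm

theorem IsStationary.pos {P : Matrix S S ℝ} (hP : P.IsIrreducible) {η : S → ℝ}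
    (hη : IsStationary P η) (i : S) : 0 < η i := by
  obtain ⟨hmem, hinv⟩ := isStationary_iff.1 hη
  refine (hmem.1 i).lt_of_ne' fun hi => ?_
  have hsum := hmem.2
  simp [eq_zero_of_vecMul_eq_self_of_apply_eq_zero hP hmem.1 hinv hi] at hsum

/-- Subtract from `ν` the largest multiple of `η` below it: the difference is invariant, nonnegative
and has a zero entry. -/
theorem IsStationary.eq {P : Matrix S S ℝ} (hP : P.IsIrreducible) {η ν : S → ℝ}
    (hη : IsStationary P η) (hν : IsStationary P ν) : η = ν := by
  have : Nonempty S :=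
    (Finset.nonempty_of_sum_ne_zero (hη.1.2.trans_ne one_ne_zero)).to_type
  obtain ⟨k, hk⟩ := Finite.exists_min fun i => ν i / η i
  set c := ν k / η k
  have hnonneg : 0 ≤ ν - c • η := fun i =>
    sub_nonneg.2 ((le_div_iff₀ (hη.pos hP i)).1 (hk i))
  have hinv : Matrix.vecMul (ν - c • η) P = ν - c • η := by
    rw [Matrix.sub_vecMul, Matrix.smul_vecMul, (isStationary_iff.1 hη).2,
      (isStationary_iff.1 hν).2]
  have hk_zero : (ν - c • η) k = 0 :=
    sub_eq_zero.2 (div_mul_cancel₀ _ (hη.pos hP k).ne').symm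
  have hνη : ν = c • η :=
    sub_eq_zero.1 (eq_zero_of_vecMul_eq_self_of_apply_eq_zero hP hnonneg hinv hk_zero)
  have hc : c = 1 := by
    have hsum := hν.1.2
    simp only [hνη, Pi.smul_apply, smul_eq_mul] at hsum
    rwa [← Finset.mul_sum, hη.1.2, mul_one] at hsum
  rw [hνη, hc, one_smul]

theorem Game.statDist_eq {Up Ua : Type*} [Fintype Up] [Fintype Ua] {d : ℕ}
    {G : Game S Up Ua d} (hG : G.Ergodic) {πp : Strategy S Up} {πa : Strategy S Ua} {ν : S → ℝ}
    (hν : IsStationary (G.trans πp πa) ν) : G.statDist πp πa = ν :=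
  IsStationary.eq (hG πp πa) (Classical.epsilon_spec ⟨ν, hν⟩) hν

end StationaryLaws

section WindowMean

variable {E : Type*} [AddCommGroup E] [Module ℝ E]

/-- The average of `g` over the time window `[l, r)`. It is meant for `l < r`; the empty window
`l = r` gets the average `0`. -/
noncomputable def windowMean (g : ℕ → E) (l r : ℕ) : E :=
  ((r : ℝ) - l)⁻¹ • ∑ j ∈ Finset.Ico l r, g j

theorem map_windowMean {F : Type*} [AddCommGroup F] [Module ℝ F] (L : E →ₗ[ℝ] F)
    (g : ℕ → E) (l r : ℕ) : L (windowMean g l r) = windowMean (fun j => L (g j)) l r := by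
  rw [windowMean, map_smul, map_sum, windowMean]

theorem windowMean_sub (g h : ℕ → E) (l r : ℕ) :
    windowMean (fun j => g j - h j) l r = windowMean g l r - windowMean h l r := by
  rw [windowMean, Finset.sum_sub_distrib, smul_sub, windowMean, windowMean]

theorem windowMean_congr {g h : ℕ → E} {l r : ℕ} (hgh : ∀ j ∈ Finset.Ico l r, g j = h j) :
    windowMean g l r = windowMean h l r := by
  rw [windowMean, Finset.sum_congr rfl hgh, windowMean]

theorem windowMean_mem {s : Set E} (hs : Convex ℝ s) {g : ℕ → E} {l r : ℕ} (hlr : l < r)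
    (hg : ∀ j ∈ Finset.Ico l r, g j ∈ s) : windowMean g l r ∈ s := by
  have hpos : (0 : ℝ) < (r : ℝ) - l := sub_pos.2 (by exact_mod_cast hlr)
  rw [windowMean, Finset.smul_sum]
  refine hs.sum_mem (fun j _ => (inv_pos.2 hpos).le) ?_ hg
  rw [Finset.sum_const, Nat.card_Ico, nsmul_eq_mul, Nat.cast_sub hlr.le,
    mul_inv_cancel₀ hpos.ne']

theorem windowMean_succ_sub_self (f : ℕ → E) {l r : ℕ} (hlr : l ≤ r) :
    windowMean (fun j => f (j + 1) - f j) l r = ((r : ℝ) - l)⁻¹ • (f r - f l) := by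
  rw [windowMean, Finset.sum_Ico_sub f hlr]

theorem windowMean_eq_average_add_smul (g : ℕ → E) {l r : ℕ} (hlr : l < r) :
    windowMean g l r = (r : ℝ)⁻¹ • ∑ j ∈ Finset.range r, g j + ((l : ℝ) / ((r : ℝ) - l)) •
      ((r : ℝ)⁻¹ • ∑ j ∈ Finset.range r, g j - (l : ℝ)⁻¹ • ∑ j ∈ Finset.range l, g j) := by
  have hl : (0 : ℝ) ≤ l := l.cast_nonneg
  have hr : (l : ℝ) < r := by exact_mod_cast hlr
  have hne : (r : ℝ) - l ≠ 0 := (sub_pos.2 hr).ne'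
  have hr0 : (r : ℝ) ≠ 0 := (hl.trans_lt hr).ne'
  rw [windowMean, Finset.sum_Ico_eq_sub _ hlr.le]
  rcases eq_or_ne l 0 with rfl | hl0
  · simp
  · match_scalars <;> field_simp
    ring

end WindowMean

section WindowMeanLimits

variable {E : Type*} [NormedAddCommGroup E] [NormedSpace ℝ E]
variable {ι : Type*} {u : Filter ι} {l r : ι → ℕ}

theorem tendsto_windowMean_succ_sub_self {f : ℕ → E} {B : ℝ} (hf : ∀ j, ‖f j‖ ≤ B)
    (hlr : ∀ᶠ n in u, l n ≤ r n) (hlen : Tendsto (fun n => (r n : ℝ) - l n) u atTop) :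
    Tendsto (fun n => windowMean (fun j => f (j + 1) - f j) (l n) (r n)) u (𝓝 0) := by
  have hbound : IsBoundedUnder (· ≤ ·) u (norm ∘ fun n => f (r n) - f (l n)) :=
    isBoundedUnder_of ⟨B + B, fun n => norm_sub_le_of_le (hf _) (hf _)⟩
  refine ((tendsto_inv_atTop_zero.comp hlen).zero_smul_isBoundedUnder_le hbound).congr' ?_
  filter_upwards [hlr] with n hn
  exact (windowMean_succ_sub_self f hn).symm

theorem tendsto_length_atTop {c : ℝ} (hc : 1 < c) (hl : Tendsto l u atTop)
    (h : ∀ᶠ n in u, c * l n ≤ r n) : Tendsto (fun n => (r n : ℝ) - l n) u atTop := by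
  refine tendsto_atTop_mono' u ?_
    ((tendsto_natCast_atTop_atTop.comp hl).const_mul_atTop (sub_pos.2 hc))
  filter_upwards [h] with n hn
  simp only [Function.comp_apply]
  linarith

theorem tendsto_windowMean_zero {g : ℕ → E}
    (hg : Tendsto (fun n : ℕ => (n : ℝ)⁻¹ • ∑ j ∈ Finset.range n, g j) atTop (𝓝 0)) {c : ℝ}
    (hc : 1 < c) (hl : Tendsto l u atTop) (h : ∀ᶠ n in u, c * l n ≤ r n) :
    Tendsto (fun n => windowMean g (l n) (r n)) u (𝓝 0) := by
  have hlen := tendsto_length_atTop hc hl h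
  have hlt : ∀ᶠ n in u, l n < r n := (hlen.eventually_gt_atTop 0).mono fun n hn =>
    by exact_mod_cast sub_pos.1 hn
  have hr : Tendsto r u atTop := tendsto_atTop_mono' u (hlt.mono fun n hn => hn.le) hl
  have hratio : IsBoundedUnder (· ≤ ·) u (norm ∘ fun n => (l n : ℝ) / ((r n : ℝ) - l n)) := by
    refine isBoundedUnder_of_eventually_le (a := (c - 1)⁻¹) ?_
    filter_upwards [h, hlen.eventually_gt_atTop 0] with n hn hpos
    rw [Function.comp_apply, Real.norm_of_nonneg (by positivity), div_le_iff₀ hpos,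
      ← div_eq_inv_mul, le_div_iff₀ (sub_pos.2 hc)]
    linarith
  have hdiff := (hg.comp hr).sub (hg.comp hl)
  rw [sub_zero] at hdiff
  have hsum := (hg.comp hr).add (hratio.smul_tendsto_zero hdiff)
  rw [add_zero] at hsum
  refine hsum.congr' ?_
  filter_upwards [hlt] with n hn
  exact (windowMean_eq_average_add_smul g hn).symm

end WindowMeanLimits

section Compactness

variable {ι X Y Z : Type*} [TopologicalSpace X] [TopologicalSpace Y] [T2Space Y]
  [PseudoMetricSpace Z]

theorem tendsto_infDist_of_tendsto_of_isCompact {A : Set X} (hA : IsCompact A) {f : X → Y}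
    (hf : Continuous f) {g : X → Z} (hg : Continuous g) {b : Y} {B : Set Z}
    (hB : ∀ x ∈ A, f x = b → g x ∈ B) {u : Filter ι} {x : ι → X} (hx : ∀ᶠ n in u, x n ∈ A)
    (hlim : Tendsto (fun n => f (x n)) u (𝓝 b)) :
    Tendsto (fun n => Metric.infDist (g (x n)) B) u (𝓝 0) := by
  refine (tendsto_iff_ultrafilter _ _ _).2 fun v hv => ?_
  obtain ⟨a, haA, ha⟩ := hA.ultrafilter_le_nhds (v.map x) (le_principal_iff.2 (hv hx))
  have hva : Tendsto x v (𝓝 a) := ha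
  have hfa : f a = b := tendsto_nhds_unique ((hf.tendsto a).comp hva) (hlim.mono_left hv)
  have hinf := ((Metric.continuous_infDist_pt B).comp hg).tendsto a |>.comp hva
  rwa [Function.comp_apply, Metric.infDist_zero_of_mem (hB a haA hfa)] at hinf

end Compactness

section OccupationLaws

variable {S Up Ua : Type*}

/-- Transitions `(θ, u^p, u^a, θ')`: a state, the two actions taken there, and the next state. -/
abbrev Transition (S Up Ua : Type*) : Type _ := S × Up × Ua × S

/-- The transition made at time `j` along given states and actions. -/
def transition (θ : ℕ → S) (up : ℕ → Up) (ua : ℕ → Ua) (j : ℕ) : Transition S Up Ua :=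
  (θ j, up j, ua j, θ (j + 1))

/-- The law of a state and the adversary's action when the state has law `ν` and the adversary uses
the strategy `β`. -/
def jointLaw [Fintype Ua] (ν : S → ℝ) (β : Strategy S Ua) (y : S × Ua) : ℝ :=
  ν y.1 * β y.1 y.2

variable [Fintype S] [Fintype Ua]

theorem jointLaw_mem_stdSimplex {ν : S → ℝ} (hν : ν ∈ stdSimplex ℝ S) (β : Strategy S Ua) :
    jointLaw ν β ∈ stdSimplex ℝ (S × Ua) := by
  refine ⟨fun y => mul_nonneg (hν.1 _) (stdSimplex.zero_le _ _), ?_⟩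
  simp only [jointLaw, Fintype.sum_prod_type, ← Finset.mul_sum, stdSimplex.sum_eq_one, mul_one,
    hν.2]

theorem exists_mul_stdSimplex_eq [Nonempty Ua] {w : Ua → ℝ} (hw : 0 ≤ w) :
    ∃ β : stdSimplex ℝ Ua, ∀ b, (∑ b', w b') * β b = w b := by
  rcases eq_or_ne (∑ b', w b') 0 with hzero | hne
  · obtain ⟨β⟩ : Nonempty (stdSimplex ℝ Ua) := inferInstance
    refine ⟨β, fun b => ?_⟩
    rw [hzero, zero_mul, (Finset.sum_eq_zero_iff_of_nonneg fun b _ => hw b).1 hzero b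
      (Finset.mem_univ b)]
  · refine ⟨⟨fun b => w b / ∑ b', w b', fun b =>
      div_nonneg (hw b) (Finset.sum_nonneg fun b' _ => hw b'), ?_⟩, fun b => ?_⟩
    · rw [← Finset.sum_div, div_self hne]
    · exact mul_div_cancel₀ _ hne

theorem exists_jointLaw_eq {w : S × Ua → ℝ} (hw : w ∈ stdSimplex ℝ (S × Ua)) :
    ∃ ν ∈ stdSimplex ℝ S, ∃ β : Strategy S Ua, jointLaw ν β = w := by
  have : Nonempty (S × Ua) :=
    (Finset.nonempty_of_sum_ne_zero (hw.2.trans_ne one_ne_zero)).to_type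
  have : Nonempty Ua := this.map Prod.snd
  choose β hβ using fun s => exists_mul_stdSimplex_eq fun b => hw.1 (s, b)
  refine ⟨fun s => ∑ b, w (s, b), ⟨fun s => Finset.sum_nonneg fun b _ => hw.1 _, ?_⟩, β,
    funext fun y => hβ y.1 y.2⟩
  rw [← Fintype.sum_prod_type, hw.2]

variable [Fintype Up] {d : ℕ}

/-- The law of a transition when the state and the adversary's action have joint law `w` and the
player uses the strategy `πp`; it is linear in `w`. -/
def Game.flow (G : Game S Up Ua d) (πp : Strategy S Up) :
    (S × Ua → ℝ) →ₗ[ℝ] (Transition S Up Ua → ℝ) where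
  toFun w t := w (t.1, t.2.2.1) * πp t.1 t.2.1 * G.p t.1 t.2.1 t.2.2.1 t.2.2.2
  map_add' v w := by ext t; simp only [Pi.add_apply]; ring
  map_smul' c w := by ext t; simp only [Pi.smul_apply, smul_eq_mul, RingHom.id_apply]; ring

/-- The expected reward of a transition with law `z`. -/
def Game.expectedReward (G : Game S Up Ua d) : (Transition S Up Ua → ℝ) →ₗ[ℝ] Vec d :=
  Fintype.linearCombination ℝ fun t => G.κ t.1 t.2.1 t.2.2.1

/-- The change of the law of the state in a transition with law `z`. -/
def netFlux [DecidableEq S] : (Transition S Up Ua → ℝ) →ₗ[ℝ] (S → ℝ) :=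
  Fintype.linearCombination ℝ fun t => Pi.single t.2.2.2 1 - Pi.single t.1 1

theorem Game.sum_flow_jointLaw_smul (G : Game S Up Ua d) (πp : Strategy S Up) (ν : S → ℝ)
    (β : Strategy S Ua) {E : Type*} [AddCommGroup E] [Module ℝ E] (f : Transition S Up Ua → E) :
    ∑ t, G.flow πp (jointLaw ν β) t • f t =
      ∑ s, ∑ a, ∑ b, (ν s * πp s a * β s b) • ∑ k, G.p s a b k • f (s, a, b, k) := by
  simp only [Game.flow, LinearMap.coe_mk, AddHom.coe_mk, jointLaw, Fintype.sum_prod_type,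
    Finset.smul_sum, smul_smul]
  refine Fintype.sum_congr _ _ fun s => Fintype.sum_congr _ _ fun a => Fintype.sum_congr _ _
    fun b => Fintype.sum_congr _ _ fun k => ?_
  congr 1
  ring

theorem Game.expectedReward_flow_jointLaw (G : Game S Up Ua d) (πp : Strategy S Up) (ν : S → ℝ)
    (β : Strategy S Ua) : G.expectedReward (G.flow πp (jointLaw ν β)) =
      ∑ s, ∑ a, ∑ b, (ν s * πp s a * β s b) • G.κ s a b := by
  rw [Game.expectedReward, Fintype.linearCombination_apply, Game.sum_flow_jointLaw_smul]
  simp only [← Finset.sum_smul, stdSimplex.sum_eq_one, one_smul]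

theorem Game.netFlux_flow_jointLaw [DecidableEq S] (G : Game S Up Ua d) (πp : Strategy S Up)
    (ν : S → ℝ) (β : Strategy S Ua) : netFlux (G.flow πp (jointLaw ν β)) =
      Matrix.vecMul ν (G.trans πp β) - ν := by
  have hstart : ∑ t, G.flow πp (jointLaw ν β) t • (Pi.single t.1 1 : S → ℝ) = ν := by
    rw [Game.sum_flow_jointLaw_smul]
    simp only [← Finset.sum_smul, stdSimplex.sum_eq_one, one_smul, ← Finset.mul_sum, mul_one]
    exact (pi_eq_sum_univ' ν).symm
  have hend : ∑ t, G.flow πp (jointLaw ν β) t • (Pi.single t.2.2.2 1 : S → ℝ) =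
      Matrix.vecMul ν (G.trans πp β) := by
    rw [Game.sum_flow_jointLaw_smul]
    ext k
    simp [Matrix.vecMul, dotProduct, Game.trans, Pi.single_apply, Finset.mul_sum, mul_assoc]
  simp only [netFlux, Fintype.linearCombination_apply, smul_sub, Finset.sum_sub_distrib, hstart,
    hend]

theorem Game.expectedReward_flow_mem_rewardSet [DecidableEq S] {G : Game S Up Ua d}
    (hG : G.Ergodic) (πp : Strategy S Up) {w : S × Ua → ℝ} (hw : w ∈ stdSimplex ℝ (S × Ua))
    (hflux : netFlux (G.flow πp w) = 0) : G.expectedReward (G.flow πp w) ∈ G.rewardSet πp := by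
  obtain ⟨ν, hν, β, rfl⟩ := exists_jointLaw_eq hw
  rw [Game.netFlux_flow_jointLaw, sub_eq_zero] at hflux
  refine ⟨β, ?_⟩
  rw [Game.meanReward, Game.statDist_eq hG (isStationary_iff.2 ⟨hν, hflux⟩),
    Game.expectedReward_flow_jointLaw]

theorem Game.expectedReward_single [DecidableEq S] [DecidableEq Up] [DecidableEq Ua]
    (G : Game S Up Ua d) (t : Transition S Up Ua) :
    G.expectedReward (Pi.single t 1) = G.κ t.1 t.2.1 t.2.2.1 := by
  rw [Game.expectedReward, Fintype.linearCombination_apply_single, one_smul]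

theorem netFlux_single [DecidableEq S] [DecidableEq Up] [DecidableEq Ua]
    (t : Transition S Up Ua) :
    netFlux (Pi.single t 1) = (Pi.single t.2.2.2 1 - Pi.single t.1 1 : S → ℝ) := by
  rw [netFlux, Fintype.linearCombination_apply_single, one_smul]

end OccupationLaws

section Deviations

variable {S Up Ua : Type*} [Fintype S] [Fintype Up] [Fintype Ua] {d : ℕ}
  [DecidableEq S]

/-- The average over the window `[l, r)` of the conditional laws of the state and the adversary's
action given the past. -/
noncomputable def meanJointLaw (θ : ℕ → S) (α : ℕ → Strategy S Ua) (l r : ℕ) : S × Ua → ℝ :=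
  windowMean (fun j => jointLaw (Pi.single (θ j) 1) (α j)) l r

theorem meanJointLaw_mem_stdSimplex (θ : ℕ → S) (α : ℕ → Strategy S Ua) {l r : ℕ}
    (hlr : l < r) :
    meanJointLaw θ α l r ∈ stdSimplex ℝ (S × Ua) :=
  windowMean_mem (convex_stdSimplex ℝ _) hlr fun j _ =>
    jointLaw_mem_stdSimplex (single_mem_stdSimplex ℝ (θ j)) (α j)

variable [DecidableEq Up] [DecidableEq Ua]

/-- The point mass at the transition made at time `j`, minus the law which the state at time `j` and
the strategies `π j` and `α j` assign to this transition. -/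
def Game.deviation (G : Game S Up Ua d) (θ : ℕ → S) (up : ℕ → Up) (ua : ℕ → Ua)
    (π : ℕ → Strategy S Up) (α : ℕ → Strategy S Ua) (j : ℕ) : Transition S Up Ua → ℝ :=
  Pi.single (transition θ up ua j) 1 - G.flow (π j) (jointLaw (Pi.single (θ j) 1) (α j))

variable {G : Game S Up Ua d} {θ : ℕ → S} {up : ℕ → Up} {ua : ℕ → Ua} {π : ℕ → Strategy S Up}
  {α : ℕ → Strategy S Ua}

theorem Game.windowMean_deviation {πp : Strategy S Up} {l r : ℕ}
    (hπ : ∀ j ∈ Finset.Ico l r, π j = πp) :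
    windowMean (G.deviation θ up ua π α) l r =
      windowMean (fun j => Pi.single (transition θ up ua j) 1) l r -
        G.flow πp (meanJointLaw θ α l r) := by
  rw [meanJointLaw, map_windowMean, ← windowMean_sub]
  exact windowMean_congr fun j hj => by rw [Game.deviation, hπ j hj]

theorem Game.expectedReward_windowMean_deviation {πp : Strategy S Up} {l r : ℕ}
    (hπ : ∀ j ∈ Finset.Ico l r, π j = πp) :
    G.expectedReward (windowMean (G.deviation θ up ua π α) l r) =
      windowMean (fun j => G.κ (θ j) (up j) (ua j)) l r -
        G.expectedReward (G.flow πp (meanJointLaw θ α l r)) := by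
  rw [Game.windowMean_deviation hπ, map_sub, map_windowMean]
  simp only [Game.expectedReward_single, transition]

theorem Game.netFlux_windowMean_deviation {πp : Strategy S Up} {l r : ℕ}
    (hπ : ∀ j ∈ Finset.Ico l r, π j = πp) :
    netFlux (windowMean (G.deviation θ up ua π α) l r) =
      windowMean (fun j => Pi.single (θ (j + 1)) 1 - Pi.single (θ j) 1) l r -
        netFlux (G.flow πp (meanJointLaw θ α l r)) := by
  rw [Game.windowMean_deviation hπ, map_sub, map_windowMean]
  simp only [netFlux_single, transition]

variable {ι : Type*} {u : Filter ι} {l r : ι → ℕ}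

theorem Game.tendsto_netFlux_meanJointLaw {πp : Strategy S Up}
    (hlen : Tendsto (fun n => (r n : ℝ) - l n) u atTop)
    (hπ : ∀ᶠ n in u, ∀ j ∈ Finset.Ico (l n) (r n), π j = πp)
    (h : Tendsto (fun n => windowMean (G.deviation θ up ua π α) (l n) (r n)) u (𝓝 0)) :
    Tendsto (fun n => netFlux (G.flow πp (meanJointLaw θ α (l n) (r n)))) u (𝓝 0) := by
  have hle : ∀ᶠ n in u, l n ≤ r n := (hlen.eventually_ge_atTop 0).mono fun n hn =>
    by exact_mod_cast sub_nonneg.1 hn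
  have htele := tendsto_windowMean_succ_sub_self (E := S → ℝ) (f := fun j => Pi.single (θ j) 1)
    (B := 1) (fun j => by rw [Pi.norm_single, norm_one]) hle hlen
  have hdev := htele.sub
    ((netFlux.continuous_of_finiteDimensional.tendsto' 0 0 (map_zero netFlux)).comp h)
  rw [sub_zero] at hdev
  refine hdev.congr' ?_
  filter_upwards [hπ] with n hn
  rw [Function.comp_apply, Game.netFlux_windowMean_deviation hn, sub_sub_cancel]

theorem Game.tendsto_infDist_rewardSet (hG : G.Ergodic) {πp : Strategy S Up}
    (hlen : Tendsto (fun n => (r n : ℝ) - l n) u atTop)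
    (hπ : ∀ᶠ n in u, ∀ j ∈ Finset.Ico (l n) (r n), π j = πp)
    (h : Tendsto (fun n => windowMean (G.deviation θ up ua π α) (l n) (r n)) u (𝓝 0)) :
    Tendsto (fun n => Metric.infDist (windowMean (fun j => G.κ (θ j) (up j) (ua j)) (l n) (r n))
      (G.rewardSet πp)) u (𝓝 0) := by
  have hmem : ∀ᶠ n in u, meanJointLaw θ α (l n) (r n) ∈ stdSimplex ℝ (S × Ua) :=
    (hlen.eventually_gt_atTop 0).mono fun n hn =>
      meanJointLaw_mem_stdSimplex θ α (by exact_mod_cast sub_pos.1 hn)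
  have hmean := tendsto_infDist_of_tendsto_of_isCompact (isCompact_stdSimplex ℝ (S × Ua))
    (netFlux ∘ₗ G.flow πp).continuous_of_finiteDimensional
    (G.expectedReward ∘ₗ G.flow πp).continuous_of_finiteDimensional
    (fun w hw => Game.expectedReward_flow_mem_rewardSet hG πp hw) hmem
    (Game.tendsto_netFlux_meanJointLaw hlen hπ h)
  have hdist := ((G.expectedReward.continuous_of_finiteDimensional.tendsto' 0 0
    (map_zero G.expectedReward)).comp h).norm
  rw [norm_zero] at hdist
  refine squeeze_zero' (.of_forall fun n => Metric.infDist_nonneg) ?_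
    ((hmean.add hdist).trans_eq (by rw [add_zero]))
  filter_upwards [hπ] with n hn
  rw [Function.comp_apply, Game.expectedReward_windowMean_deviation hn, ← dist_eq_norm]
  exact Metric.infDist_le_infDist_add_dist

end Deviations

section ControlledPlay

variable {S Up Ua : Type*} [Fintype S] [Fintype Up] [Fintype Ua] {d : ℕ} {G : Game S Up Ua d}
  {Ω : Type*} [mΩ : MeasurableSpace Ω] {μ : Measure Ω} {ℱ : Filtration ℕ mΩ}
  {θ : ℕ → Ω → S} {up : ℕ → Ω → Up} {ua : ℕ → Ω → Ua}

/-- A play in which both sides choose their strategies arbitrarily: at time `n` the player uses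
`π n` and the adversary `α n`, and given the past `ℱ n` the actions are drawn independently from
these strategies, then the next state from the transition kernel. Nothing is asked of `π n` and
`α n` beyond the description of the conditional probabilities. -/
structure Game.IsControlledPlay (G : Game S Up Ua d) (μ : Measure Ω) (ℱ : Filtration ℕ mΩ)
    (θ : ℕ → Ω → S) (up : ℕ → Ω → Up) (ua : ℕ → Ω → Ua) (π : ℕ → Ω → Strategy S Up)
    (α : ℕ → Ω → Strategy S Ua) : Prop where
  measurableSet_state : ∀ n s, MeasurableSet[ℱ n] {ω | θ n ω = s}
  measurableSet_player : ∀ n a, MeasurableSet[ℱ (n + 1)] {ω | up n ω = a}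
  measurableSet_adversary : ∀ n b, MeasurableSet[ℱ (n + 1)] {ω | ua n ω = b}
  condExp_step : ∀ n a b k,
    μ⟦{ω | up n ω = a ∧ ua n ω = b ∧ θ (n + 1) ω = k} | ℱ n⟧ =ᵐ[μ] fun ω =>
      π n ω (θ n ω) a * α n ω (θ n ω) b * G.p (θ n ω) a b k

theorem IsPlay.isControlledPlay {K D : Set (Vec d)} {C : Scheme G K D} {x₀ : Vec d}
    {α : ℕ → Ω → Strategy S Ua} (h : IsPlay C x₀ μ ℱ θ up ua α) :
    G.IsControlledPlay μ ℱ θ up ua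
      (fun n ω => C.current (average x₀ (G.reward θ up ua ω)) n) α :=
  ⟨h.meas_state, h.meas_player, h.meas_adversary, h.step⟩

variable {π : ℕ → Ω → Strategy S Up} {α : ℕ → Ω → Strategy S Ua}

theorem Game.IsControlledPlay.measurableSet_transition (h : G.IsControlledPlay μ ℱ θ up ua π α)
    (n : ℕ) (t : Transition S Up Ua) : MeasurableSet[ℱ (n + 1)]
      {ω | transition (θ · ω) (up · ω) (ua · ω) n = t} := by
  obtain ⟨s, a, b, k⟩ := t
  simp only [transition, Prod.mk.injEq]
  exact (ℱ.mono n.le_succ _ (h.measurableSet_state n s)).inter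
    ((h.measurableSet_player n a).inter
      ((h.measurableSet_adversary n b).inter (h.measurableSet_state (n + 1) k)))

variable [IsFiniteMeasure μ] [DecidableEq S]

theorem Game.IsControlledPlay.condExp_transition (h : G.IsControlledPlay μ ℱ θ up ua π α)
    (n : ℕ) (t : Transition S Up Ua) :
    μ⟦{ω | transition (θ · ω) (up · ω) (ua · ω) n = t} | ℱ n⟧ =ᵐ[μ] fun ω =>
      G.flow (π n ω) (jointLaw (Pi.single (θ n ω) 1) (α n ω)) t := by
  obtain ⟨s, a, b, k⟩ := t
  set A : Set Ω := {ω | up n ω = a ∧ ua n ω = b ∧ θ (n + 1) ω = k}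
  have hA : MeasurableSet A := ℱ.le (n + 1) _ ((h.measurableSet_player n a).inter
    ((h.measurableSet_adversary n b).inter (h.measurableSet_state (n + 1) k)))
  have hset : {ω | transition (θ · ω) (up · ω) (ua · ω) n = (s, a, b, k)} =
      {ω | θ n ω = s} ∩ A := by
    simp only [transition, Prod.mk.injEq]
    rfl
  rw [hset, ← Set.indicator_indicator]
  filter_upwards [condExp_indicator ((integrable_const (1 : ℝ)).indicator hA)
    (h.measurableSet_state n s), h.condExp_step n a b k] with ω hpull hstep
  rw [hpull]
  by_cases hs : θ n ω = s
  · rw [Set.indicator_of_mem (s := {ω | θ n ω = s}) hs, hstep]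
    simp [Game.flow, jointLaw, hs, mul_comm]
  · simp [Game.flow, jointLaw, hs]

theorem Game.IsControlledPlay.ae_tendsto_average_deviation [DecidableEq Up] [DecidableEq Ua]
    (h : G.IsControlledPlay μ ℱ θ up ua π α) :
    ∀ᵐ ω ∂μ, Tendsto (fun n : ℕ => (n : ℝ)⁻¹ • ∑ j ∈ Finset.range n,
      G.deviation (θ · ω) (up · ω) (ua · ω) (π · ω) (α · ω) j) atTop (𝓝 0) := by
  simp only [tendsto_pi_nhds, ae_all_iff]
  intro t
  filter_upwards [ae_tendsto_average_indicator_sub_condExp (h.measurableSet_transition · t),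
    ae_all_iff.2 (h.condExp_transition · t)] with ω havg hcond
  refine havg.congr fun n => ?_
  rw [Pi.smul_apply, smul_eq_mul, Finset.sum_apply]
  refine congrArg _ (Finset.sum_congr rfl fun j _ => ?_)
  rw [hcond j, Game.deviation, Pi.sub_apply, Pi.single_apply, Set.indicator_apply]
  simp only [Set.mem_ofPred_eq, eq_comm]

end ControlledPlay

section Clock

theorem clock_eq_harmonic (n : ℕ) : clock n = harmonic n := by
  rw [harmonic_eq_sum_Icc, clock]
  simp

theorem tendsto_clock_sub_log :
    Tendsto (fun n : ℕ => clock n - Real.log n) atTop (𝓝 Real.eulerMascheroniConstant) := by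
  simpa only [clock_eq_harmonic] using Real.tendsto_harmonic_sub_log

theorem clock_mono : Monotone clock := fun _ _ h =>
  Finset.sum_le_sum_of_subset_of_nonneg (Finset.Icc_subset_Icc_right h) fun _ _ _ => by positivity

variable {ι : Type*} {u : Filter ι} {l r : ι → ℕ} {T : ℝ}

theorem tendsto_div_of_tendsto_clock_sub (hl : Tendsto l u atTop) (hr : Tendsto r u atTop)
    (h : Tendsto (fun n => clock (r n) - clock (l n)) u (𝓝 T)) :
    Tendsto (fun n => (r n : ℝ) / l n) u (𝓝 (Real.exp T)) := by
  have hlog := h.sub ((tendsto_clock_sub_log.comp hr).sub (tendsto_clock_sub_log.comp hl))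
  rw [sub_self, sub_zero] at hlog
  refine ((Real.continuous_exp.tendsto T).comp hlog).congr' ?_
  filter_upwards [hl.eventually_gt_atTop 0, hr.eventually_gt_atTop 0] with n hln hrn
  have hln' : (0 : ℝ) < l n := by exact_mod_cast hln
  have hrn' : (0 : ℝ) < r n := by exact_mod_cast hrn
  rw [← Real.exp_log (div_pos hrn' hln'), Real.log_div hrn'.ne' hln'.ne']
  simp only [Function.comp_apply]
  congr 1
  ring

theorem eventually_lt_of_tendsto_clock_sub (hT : 0 < T)
    (h : Tendsto (fun n => clock (r n) - clock (l n)) u (𝓝 T)) : ∀ᶠ n in u, l n < r n :=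
  (h.eventually_const_lt hT).mono fun _ hn => clock_mono.reflect_lt (sub_pos.1 hn)

theorem tendsto_sum_Ico_one_div_atTop (k : ℕ) :
    Tendsto (fun m => ∑ i ∈ Finset.Ico k m, (1 : ℝ) / i) atTop atTop := by
  have hdiv : Tendsto (fun m => ∑ i ∈ Finset.range m, (1 : ℝ) / i) atTop atTop :=
    (not_summable_iff_tendsto_nat_atTop_of_nonneg fun i => by positivity).1
      Real.not_summable_one_div_natCast
  refine (tendsto_atTop_add_const_right _ (-∑ i ∈ Finset.range k, (1 : ℝ) / i) hdiv).congr' ?_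
  filter_upwards [eventually_ge_atTop k] with m hm
  rw [Finset.sum_Ico_eq_sub _ hm, sub_eq_add_neg]

end Clock

section Switching

variable {S Up Ua : Type*} [Fintype S] [Fintype Up] [Fintype Ua] {d : ℕ}
  {G : Game S Up Ua d} {K D : Set (Vec d)}

theorem iUnion_layer (K : Set (Vec d)) (hD : D.Nonempty) :
    ⋃ n, layer K D n = K \ closure D := by
  ext x
  simp only [Set.mem_iUnion, Set.mem_sdiff, Metric.mem_closure_iff_infDist_zero hD]
  constructor
  · rintro ⟨n, hxK, hlow, -⟩
    exact ⟨hxK, (lt_of_lt_of_le (by positivity) hlow).ne'⟩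
  · rintro ⟨hxK, hne⟩
    have hpos : 0 < Metric.infDist x D := Metric.infDist_nonneg.lt_of_ne' hne
    refine ⟨⌊1 / Metric.infDist x D⌋₊, hxK, ?_, ?_⟩
    · rw [div_le_comm₀ (by positivity) hpos]
      exact (Nat.lt_floor_add_one _).le
    · rw [← le_div_iff₀ hpos]
      exact Nat.floor_le (by positivity)

theorem Scheme.centers_subset (C : Scheme G K D) (hD : D.Nonempty) :
    C.centers ⊆ K \ closure D := by
  rw [← iUnion_layer K hD]
  exact Set.iUnion_mono C.net_subset

theorem Scheme.exists_mem_centers (C : Scheme G K D) (hD : D.Nonempty) {x : Vec d}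
    (hx : x ∈ K \ closure D) : ∃ q ∈ C.centers, x ∈ Metric.ball q (C.ρ q / 2) := by
  rw [← iUnion_layer K hD] at hx
  obtain ⟨n, hn⟩ := Set.mem_iUnion.1 hx
  obtain ⟨q, hq, hxq⟩ := Set.mem_iUnion₂.1 (C.net_cover n hn)
  exact ⟨q, Set.mem_iUnion.2 ⟨n, hq⟩, hxq⟩

theorem Scheme.isLeastCenter_center (C : Scheme G K D) (hD : D.Nonempty) {x : Vec d}
    (hx : x ∈ K \ closure D) : C.IsLeastCenter x (C.center x) := by
  obtain ⟨q, hq, hmin⟩ := exists_minimalFor_of_wellFoundedLT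
    (fun q => q ∈ C.centers ∧ x ∈ Metric.ball q (C.ρ q / 2)) C.I (C.exists_mem_centers hD hx)
  exact Classical.epsilon_spec (p := C.IsLeastCenter x) ⟨q, hq, fun q' hq' hxq' =>
    (le_total (C.I q) (C.I q')).elim id (hmin ⟨hq', hxq'⟩)⟩

theorem Scheme.T_pos (C : Scheme G K D) (hD : D.Nonempty) {q : Vec d} (hq : q ∈ C.centers) :
    0 < C.T q := by
  have hρ := C.ρ_pos q (C.centers_subset hD hq)
  have hv : 0 ≤ G.vmax K := Real.sSup_nonneg fun v ⟨_, _, _, _, _, hv⟩ => hv ▸ norm_nonneg _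
  exact lt_of_le_of_lt (by positivity) (C.T_spec q hq).1

theorem Scheme.switch_lt_switch_succ (C : Scheme G K D) (hD : D.Nonempty) (x : ℕ → Vec d)
    (n : ℕ) : C.switch x n < C.switch x (n + 1) := by
  rw [Scheme.switch.eq_2]
  split_ifs with hx
  · set T := C.T (C.center (x (C.switch x n)))
    set k := max 1 (C.switch x n)
    have hT : 0 < T := C.T_pos hD (C.isLeastCenter_center hD hx).1.1
    obtain ⟨m, hm⟩ := ((tendsto_sum_Ico_one_div_atTop k).eventually_gt_atTop T).exists
    refine (le_max_right 1 _).trans_lt (lt_of_not_ge fun hle => ?_)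
    have hlt : T < ∑ i ∈ Finset.Ico k (sInf _), (1 : ℝ) / i :=
      Nat.sInf_mem (s := {m | T < ∑ i ∈ Finset.Ico k m, (1 : ℝ) / i}) ⟨m, hm⟩
    rw [Finset.Ico_eq_empty_of_le hle, Finset.sum_empty] at hlt
    exact hT.not_gt hlt
  · exact Nat.lt_succ_self _

theorem Scheme.strictMono_switch (C : Scheme G K D) (hD : D.Nonempty) (x : ℕ → Vec d) :
    StrictMono (C.switch x) :=
  strictMono_nat_of_lt_succ (C.switch_lt_switch_succ hD x)

theorem Scheme.lastSwitch_eq (C : Scheme G K D) (hD : D.Nonempty) (x : ℕ → Vec d) {k j : ℕ}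
    (hkj : C.switch x k ≤ j) (hjk : j < C.switch x (k + 1)) :
    C.lastSwitch x j = C.switch x k := by
  classical
  have hmono := C.strictMono_switch hD x
  refine congrArg (C.switch x) (Nat.findGreatest_eq_iff.2
    ⟨(hmono.id_le k).trans hkj, fun _ => hkj, fun n hkn _ hnj => ?_⟩)
  exact (hmono.monotone (Nat.succ_le_of_lt hkn)).not_gt (hnj.trans_lt hjk)

variable {C : Scheme G K D} {x : ℕ → Vec d} {m l r : ℕ → ℕ} {Tl Tr : ℝ} {q : Vec d}

theorem Dagger.current_eq (h : Dagger C x m l r Tl Tr q) (hD : D.Nonempty) {n j : ℕ}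
    (hj : j ∈ Finset.Ico (l n) (r n)) : C.current x j = C.strat q := by
  obtain ⟨hml, -, hrm⟩ := h.window n
  obtain ⟨hlj, hjr⟩ := Finset.mem_Ico.1 hj
  obtain ⟨hmem, hcenter⟩ := h.center_eq n
  rw [Scheme.current, C.lastSwitch_eq hD x (hml.trans hlj) (hjr.trans_le hrm), Scheme.adopt,
    if_pos hmem, hcenter]

theorem Dagger.tendsto_left_atTop (h : Dagger C x m l r Tl Tr q) (hD : D.Nonempty) :
    Tendsto l atTop atTop :=
  tendsto_atTop_mono (fun n => (h.window n).1)
    (((C.strictMono_switch hD x).comp h.strictMono).tendsto_atTop)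

theorem Dagger.tendsto_clock_sub (h : Dagger C x m l r Tl Tr q) :
    Tendsto (fun n => clock (r n) - clock (l n)) atTop (𝓝 (Tr - Tl)) := by
  simpa only [sub_sub_sub_cancel_right] using h.tendsto_right.sub h.tendsto_left

end Switching

end Approach

theorem mainTheorem2_general {S Up Ua : Type*} [Fintype S] [Fintype Up] [Fintype Ua] {d : ℕ}
    {G : Approach.Game S Up Ua d} (hG : G.Ergodic)
    {Ω : Type*} [mΩ : MeasurableSpace Ω] {μ : Measure Ω} [IsFiniteMeasure μ]
    {ℱ : Filtration ℕ mΩ} {θ : ℕ → Ω → S} {up : ℕ → Ω → Up} {ua : ℕ → Ω → Ua}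
    {π : ℕ → Ω → Approach.Strategy S Up} {α : ℕ → Ω → Approach.Strategy S Ua}
    (hplay : G.IsControlledPlay μ ℱ θ up ua π α) :
    ∀ᵐ ω ∂μ, ∀ {ι : Type*} (u : Filter ι) (l r : ι → ℕ) (T : ℝ) (πp : Approach.Strategy S Up),
      0 < T → Tendsto l u atTop →
      Tendsto (fun n => Approach.clock (r n) - Approach.clock (l n)) u (𝓝 T) →
      (∀ᶠ n in u, ∀ j ∈ Finset.Ico (l n) (r n), π j ω = πp) →
        Tendsto (fun n => Metric.infDist
            (((r n : ℝ) - (l n : ℝ))⁻¹ • ∑ j ∈ Finset.Ico (l n) (r n), G.reward θ up ua ω j)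
            (G.rewardSet πp)) u (𝓝 0) ∧
          Tendsto (fun n => (r n : ℝ) / (l n : ℝ)) u (𝓝 (Real.exp T)) ∧
          Tendsto (fun n => ((r n : ℝ) - (l n : ℝ)) / (l n : ℝ)) u (𝓝 (Real.exp T - 1)) := by
  classical
  filter_upwards [hplay.ae_tendsto_average_deviation] with ω hω ι u l r T πp hT hl hclock hπ
  have hlr := Approach.eventually_lt_of_tendsto_clock_sub hT hclock
  have hratio : Tendsto (fun n => (r n : ℝ) / l n) u (𝓝 (Real.exp T)) :=
    Approach.tendsto_div_of_tendsto_clock_sub hl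
      (tendsto_atTop_mono' u (hlr.mono fun n hn => hn.le) hl) hclock
  have hl_pos : ∀ᶠ n in u, (0 : ℝ) < l n :=
    (hl.eventually_gt_atTop 0).mono fun n hn => Nat.cast_pos.2 hn
  obtain ⟨c, hc, hcT⟩ := exists_between (Real.one_lt_exp_iff.2 hT)
  have hprop : ∀ᶠ n in u, c * l n ≤ r n := by
    filter_upwards [hratio.eventually_const_lt hcT, hl_pos] with n hn hpos
    exact ((lt_div_iff₀ hpos).1 hn).le
  refine ⟨?_, hratio, ?_⟩
  · exact Approach.Game.tendsto_infDist_rewardSet hG (Approach.tendsto_length_atTop hc hl hprop)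
      hπ (Approach.tendsto_windowMean_zero hω hc hl hprop)
  · refine (hratio.sub_const 1).congr' (hl_pos.mono fun n hpos => ?_)
    simp only [sub_div, div_self hpos.ne']

theorem mainTheorem2 {S Up Ua : Type*} [Fintype S] [Fintype Up] [Fintype Ua] {d : ℕ}
    (G : Approach.Game S Up Ua d) (hG : G.Ergodic)
    (K : Set (Approach.Vec d)) (hK : IsCompact K) (hκ : ∀ θ a b, G.κ θ a b ∈ K)
    (D : Set (Approach.Vec d)) (hDK : D ⊆ K) (hD : D.Nonempty) (hconv : Convex ℝ (closure D))
    (C : Approach.Scheme G K D) (x₀ : Approach.Vec d)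
    {Ω : Type*} [mΩ : MeasurableSpace Ω] (μ : Measure Ω) [IsProbabilityMeasure μ]
    (ℱ : Filtration ℕ mΩ) (θ : ℕ → Ω → S) (up : ℕ → Ω → Up) (ua : ℕ → Ω → Ua)
    (α : ℕ → Ω → Approach.Strategy S Ua) (hplay : Approach.IsPlay C x₀ μ ℱ θ up ua α) :
    ∀ᵐ ω ∂μ, ∀ (m l r : ℕ → ℕ) (Tl Tr : ℝ) (q : Approach.Vec d),
      Approach.Dagger C (Approach.average x₀ (G.reward θ up ua ω)) m l r Tl Tr q →
        Tendsto (fun n => Metric.infDist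
            (((r n : ℝ) - (l n : ℝ))⁻¹ • ∑ j ∈ Finset.Ico (l n) (r n), G.reward θ up ua ω j)
            (G.rewardSet (C.strat q))) atTop (𝓝 0) ∧
          Tendsto (fun n => (r n : ℝ) / (l n : ℝ)) atTop (𝓝 (Real.exp (Tr - Tl))) ∧
          Tendsto (fun n => ((r n : ℝ) - (l n : ℝ)) / (l n : ℝ)) atTop
            (𝓝 (Real.exp (Tr - Tl) - 1)) := by
  filter_upwards [mainTheorem2_general hG hplay.isControlledPlay] with ω hω m l r Tl Tr q hdag
  exact hω atTop l r (Tr - Tl) (C.strat q) (sub_pos.2 hdag.lt) (hdag.tendsto_left_atTop hD)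
    hdag.tendsto_clock_sub (.of_forall fun n j hj => hdag.current_eq hD hj)
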